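/- Write a quaternion as $a+jb=\binom{a}{b}$ with $a,b\in\mathbf C$, so that $\binom{z_1}{z_2}\cdot\binom{w_1}{w_2}=\binom{z_1w_1-\bar z_2w_2}{\bar z_1w_2+z_2w_1}$ and $\operatorname{tr}\binom ab=a+\bar a$; a complex number $\lambda$ acts by $\binom ab\mapsto\binom{\lambda a}{\lambda b}$. On $\mathbf C^2$ with coordinates $z=(z_1,z_2)$ and Euclidean norm $|z|$ put $$\nu=z_1\tfrac{\partial}{\partial z_1}+z_2\tfrac{\partial}{\partial z_2},\quad \theta=\nu-\bar\nu,\quad e_-=-\bar z_2\tfrac{\partial}{\partial z_1}+\bar z_1\tfrac{\partial}{\partial z_2},\quad \hat e_-=\bar z_2\tfrac{\partial}{\partial\bar z_1}-z_1\tfrac{\partial}{\partial z_2},$$ $v^k_{(a,b)}=(e_-)^k z_1^az_2^b$, $w^k_{(a,b)}=(\hat e_-)^kz_2^a\bar z_1^b$, and for $0\le l\le m$, $0\le k\le m+1$ define spinors ($\mathbf H$-valued functions) on $\mathbf C^2\setminus\{0\}$ by $$\phi^{+(m,l,k)}=\sqrt{\tfrac{(m+1-k)!}{k!\,l!\,(m-l)!}}\binom{k\,v^{k-1}_{(l,m-l)}}{-v^k_{(l,m-l)}},\qquad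 \phi^{-(m,l,k)}=\sqrt{\tfrac{(m+1-k)!}{k!\,l!\,(m-l)!}}\;|z|^{-2(m+2)}\binom{w^k_{(m+1-l,l)}}{w^k_{(m-l,l+1)}}$$ (the entry $k\,v^{k-1}$ is $0$ for $k=0$). Let $\mathbf C[\phi^\pm]$ be the algebra of spinors on $\mathbf C^2\setminus\{0\}$, under the pointwise quaternion product, generated by all complex multiples of the $\phi^{\pm(m,l,k)}$, and for $N\in\mathbf Z$ let $\mathbf C[\phi^\pm;N]=\{\varphi\in\mathbf C[\phi^\pm]:\varphi(z)=|z|^N\varphi(z/|z|)\}$. Let $d_0\binom uv=\binom{d_0u}{d_0v}$ with $d_0=\frac12(\nu+\bar\nu)$ on functions, $\Theta\binom uv=\frac1{2\sqrt{-1}}\binom{\theta u}{\theta v}$, and $$c(\phi,\psi)=\frac1{2\pi^2}\int_{S^3}\operatorname{tr}(\Theta\phi\cdot\psi)\,d\sigma$$ with $\sigma$ the surface measure of the unit sphere $S^3\subset\mathbf C^2$. Let $\mathfrak g$ be a finite-dimensional complex Lie algebra with enveloping algebra $U(\mathfrak g)$, and let $(X|Y)=\operatorname{tr}_{\mathfrak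 g}(\operatorname{ad}X\,\operatorname{ad}Y)$ for $X,Y\in U(\mathfrak g)$, where $\operatorname{ad}:U(\mathfrak g)\to\operatorname{End}(\mathfrak g)$ extends the adjoint representation. Tensor products are over $\mathbf R$ and are complex vector spaces through the factor $U(\mathfrak g)$. Let $$\widehat{\mathfrak g}=(\mathbf C[\phi^\pm]\otimes U(\mathfrak g))\oplus\mathbf Ca\oplus\mathbf Cd$$ with the $\mathbf C$-bilinear bracket $$[\phi\otimes X+\lambda_1a+\mu_1d,\ \psi\otimes Y+\lambda_2a+\mu_2d]=(\phi\psi)\otimes(XY)-(\psi\phi)\otimes(YX)+\mu_1\,d_0\psi\otimes Y-\mu_2\,d_0\phi\otimes X+(X|Y)\,c(\phi,\psi)\,a.$$ **Proposition.** The centralizer $\{\xi\in\widehat{\mathfrak g}:[d,\xi]=0\}$ of $d$ in $\widehat{\mathfrak g}$ is $$(\mathbf C[\phi^\pm;0]\otimes U(\mathfrak g))\oplus\mathbf Ca\oplus\mathbf Cd.$$ That is, the natural map from this direct sum to $\widehat{\mathfrak g}$ is injective and its image is the centralizer of $d$. -/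

import Mathlib

open MeasureTheory
open scoped Quaternion TensorProduct ContDiff

noncomputable section

namespace QuatSpinor

/-! ### Quaternions as pairs of complex numbers -/

/-- The quaternion `a + j b`, for complex numbers `a`, `b` (where `ij = k = -ji`). -/
def ofPair (a b : ℂ) : ℍ[ℝ] := ⟨a.re, a.im, b.re, -b.im⟩

/-- The component `a` of the quaternion `a + j b`. -/
def fst (q : ℍ[ℝ]) : ℂ := ⟨q.re, q.imI⟩

/-- The component `b` of the quaternion `a + j b`. -/
def snd (q : ℍ[ℝ]) : ℂ := ⟨q.imJ, -q.imK⟩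

/-- The trace `a + conj a` of the quaternion `a + j b`. -/
def tr (q : ℍ[ℝ]) : ℝ := 2 * q.re

lemma re_ofPair (a b : ℂ) : (ofPair a b).re = a.re := rfl
lemma imI_ofPair (a b : ℂ) : (ofPair a b).imI = a.im := rfl
lemma imJ_ofPair (a b : ℂ) : (ofPair a b).imJ = b.re := rfl
lemma imK_ofPair (a b : ℂ) : (ofPair a b).imK = -b.im := rfl

lemma ofPair_fst_snd (q : ℍ[ℝ]) : ofPair (fst q) (snd q) = q := by
  ext <;> simp [ofPair, fst, snd]

lemma fst_ofPair (a b : ℂ) : fst (ofPair a b) = a := by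
  apply Complex.ext <;> simp [ofPair, fst]

lemma snd_ofPair (a b : ℂ) : snd (ofPair a b) = b := by
  apply Complex.ext <;> simp [ofPair, snd]

lemma tr_eq (q : ℍ[ℝ]) : (tr q : ℂ) = fst q + (starRingEnd ℂ) (fst q) := by
  apply Complex.ext <;> simp [tr, fst]; ring

/-- The product law of quaternions in terms of pairs. -/
lemma ofPair_mul (z₁ z₂ w₁ w₂ : ℂ) :
    ofPair z₁ z₂ * ofPair w₁ w₂ =
      ofPair (z₁ * w₁ - (starRingEnd ℂ) z₂ * w₂) ((starRingEnd ℂ) z₁ * w₂ + z₂ * w₁) := by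
  ext <;> simp [re_ofPair, imI_ofPair, imJ_ofPair, imK_ofPair] <;> ring

/-! ### Differential operators on functions of `z = (z₁, z₂)` -/

/-- `ℂ²` with its Euclidean norm `|z|`; the coordinates `z₁`, `z₂` are `z 0`, `z 1`. -/
abbrev C2 := EuclideanSpace ℂ (Fin 2)

/-- `ℂ² \ {0}`. -/
abbrev Punctured := {z : C2 // z ≠ 0}

/-- The Wirtinger derivative `∂/∂zᵢ`. -/
def dz (i : Fin 2) (f : C2 → ℂ) (z : C2) : ℂ :=
  (1 / 2) * (fderiv ℝ f z (EuclideanSpace.single i 1) -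
    Complex.I * fderiv ℝ f z (EuclideanSpace.single i Complex.I))

/-- The Wirtinger derivative `∂/∂(conj zᵢ)`. -/
def dzbar (i : Fin 2) (f : C2 → ℂ) (z : C2) : ℂ :=
  (1 / 2) * (fderiv ℝ f z (EuclideanSpace.single i 1) +
    Complex.I * fderiv ℝ f z (EuclideanSpace.single i Complex.I))

/-- `ν = z₁ ∂/∂z₁ + z₂ ∂/∂z₂`. -/
def nu (f : C2 → ℂ) (z : C2) : ℂ := z 0 * dz 0 f z + z 1 * dz 1 f z

/-- The conjugate vector field of `ν`. -/
def nuBar (f : C2 → ℂ) (z : C2) : ℂ :=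
  (starRingEnd ℂ) (z 0) * dzbar 0 f z + (starRingEnd ℂ) (z 1) * dzbar 1 f z

/-- The Euler (radial) derivative `(ν + conj ν) / 2` on functions. -/
def euler (f : C2 → ℂ) (z : C2) : ℂ := (1 / 2) * (nu f z + nuBar f z)

/-- The vector field `θ = ν - conj ν`. -/
def theta (f : C2 → ℂ) (z : C2) : ℂ := nu f z - nuBar f z

/-- `e₋ = - conj z₂ ∂/∂z₁ + conj z₁ ∂/∂z₂`. -/
def eMinus (f : C2 → ℂ) (z : C2) : ℂ :=
  -(starRingEnd ℂ) (z 1) * dz 0 f z + (starRingEnd ℂ) (z 0) * dz 1 f z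

/-- `ê₋ = conj z₂ ∂/∂(conj z₁) - z₁ ∂/∂z₂`. -/
def eHatMinus (f : C2 → ℂ) (z : C2) : ℂ :=
  (starRingEnd ℂ) (z 1) * dzbar 0 f z - z 0 * dz 1 f z

/-! ### The basic spinors -/

/-- The harmonic polynomial `v^k_{(a,b)} = (e₋)^k (z₁^a z₂^b)`. -/
def vPoly (k a b : ℕ) : C2 → ℂ := eMinus^[k] (fun z => z 0 ^ a * z 1 ^ b)

/-- The harmonic polynomial `w^k_{(a,b)} = (ê₋)^k (z₂^a (conj z₁)^b)`. -/
def wPoly (k a b : ℕ) : C2 → ℂ :=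
  eHatMinus^[k] (fun z => z 1 ^ a * (starRingEnd ℂ) (z 0) ^ b)

/-- The normalising constant `√((m+1-k)! / (k! l! (m-l)!))`. -/
def normConst (m l k : ℕ) : ℝ :=
  Real.sqrt ((Nat.factorial (m + 1 - k) : ℝ) /
    ((Nat.factorial k : ℝ) * (Nat.factorial l : ℝ) * (Nat.factorial (m - l) : ℝ)))

/-- The spinor `φ^{+(m,l,k)}` (for `l ≤ m`, `k ≤ m + 1`) on `ℂ² \ {0}`.
The factor `k` makes the first component `0` when `k = 0`. -/
def phiPlus (m l k : ℕ) : Punctured → ℍ[ℝ] := fun z =>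
  normConst m l k • ofPair ((k : ℂ) * vPoly (k - 1) l (m - l) z) (-vPoly k l (m - l) z)

/-- The spinor `φ^{-(m,l,k)}` (for `l ≤ m`, `k ≤ m + 1`) on `ℂ² \ {0}`. -/
def phiMinus (m l k : ℕ) : Punctured → ℍ[ℝ] := fun z =>
  (normConst m l k * (1 / ‖(z : C2)‖ ^ 2) ^ (m + 2)) •
    ofPair (wPoly k (m + 1 - l) l z) (wPoly k (m - l) (l + 1) z)

/-- The complex multiples of the basic spinors; a complex number `c` acts on
`u + j v` by `(u, v) ↦ (c u, c v)`, that is, by right multiplication. -/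
def basicSpinors : Set (Punctured → ℍ[ℝ]) :=
  {φ | ∃ (c : ℂ) (m l k : ℕ), l ≤ m ∧ k ≤ m + 1 ∧
    ((φ = fun z => phiPlus m l k z * ofPair c 0) ∨
      (φ = fun z => phiMinus m l k z * ofPair c 0))}

/-- `ℂ[φ^±]`: the algebra, under the pointwise quaternion product, of spinors on `ℂ² \ {0}`
generated by the complex multiples of the spinors `φ^{±(m,l,k)}`. -/
def Laurent : Subalgebra ℝ (Punctured → ℍ[ℝ]) := Algebra.adjoin ℝ basicSpinors

/-! ### The operators `Θ` and `d₀` on spinors -/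

/-- Extension by `0` of a function on `ℂ² \ {0}`; it only serves to take derivatives at points
of the open set `ℂ² \ {0}`. -/
def extend {E : Type*} [Zero E] (f : Punctured → E) (z : C2) : E :=
  open Classical in if h : z ≠ 0 then f ⟨z, h⟩ else 0

/-- A differential operator on functions, acting on the two components of a spinor. -/
def componentwise (T : (C2 → ℂ) → C2 → ℂ) (φ : Punctured → ℍ[ℝ]) : Punctured → ℍ[ℝ] := fun z =>
  ofPair (T (extend fun w => fst (φ w)) z) (T (extend fun w => snd (φ w)) z)

/-- The radial derivative `d₀ (u, v) = (d₀ u, d₀ v)`. -/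
def d0Fun : (Punctured → ℍ[ℝ]) → Punctured → ℍ[ℝ] := componentwise euler

/-- `Θ (u, v) = (1 / (2 √-1)) (θ u, θ v)`. -/
def ThetaFun : (Punctured → ℍ[ℝ]) → Punctured → ℍ[ℝ] :=
  componentwise fun f z => 1 / (2 * Complex.I) * theta f z

/-! #### Basic facts: smoothness and homogeneity of Laurent spinors -/

/-- `a + j b` as a real-linear equivalence. -/
def pairL : (ℂ × ℂ) ≃L[ℝ] ℍ[ℝ] := LinearEquiv.toContinuousLinearEquiv
  { toFun := fun p => ofPair p.1 p.2
    invFun := fun q => (fst q, snd q)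
    map_add' := fun p q => by
      ext <;> simp [re_ofPair, imI_ofPair, imJ_ofPair, imK_ofPair]; ring
    map_smul' := fun r p => by ext <;> simp [re_ofPair, imI_ofPair, imJ_ofPair, imK_ofPair]
    left_inv := fun p => by simp [fst_ofPair, snd_ofPair]
    right_inv := fun q => ofPair_fst_snd q }

lemma pairL_apply (p : ℂ × ℂ) : pairL p = ofPair p.1 p.2 := rfl

lemma pairL_symm_apply (q : ℍ[ℝ]) : pairL.symm q = (fst q, snd q) := rfl

lemma extend_apply {E : Type*} [Zero E] (f : Punctured → E) (z : Punctured) :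
    extend f z = f z := by
  simp [extend, z.2]

lemma extend_of_ne {E : Type*} [Zero E] (f : Punctured → E) {z : C2} (h : z ≠ 0) :
    extend f z = f ⟨z, h⟩ := by
  simp [extend, h]

lemma extend_eventuallyEq {E : Type*} [Zero E] (f : Punctured → E) (g : C2 → E)
    (h : ∀ z : Punctured, f z = g z) (z : Punctured) : extend f =ᶠ[nhds (z : C2)] g := by
  filter_upwards [isOpen_ne.mem_nhds z.2] with w hw
  rw [extend_of_ne f hw, h]

lemma vec_decomp (z : C2) :
    z = (z 0).re • (EuclideanSpace.single 0 1 : C2) + (z 0).im • EuclideanSpace.single 0 Complex.I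
      + (z 1).re • EuclideanSpace.single 1 1 + (z 1).im • EuclideanSpace.single 1 Complex.I := by
  ext i
  fin_cases i <;> apply Complex.ext <;> simp

lemma euler_eq (f : C2 → ℂ) (z : C2) : euler f z = (1 / 2 : ℝ) • fderiv ℝ f z z := by
  conv_rhs => rw [show fderiv ℝ f z z = fderiv ℝ f z ((z 0).re • (EuclideanSpace.single 0 1 : C2)
      + (z 0).im • EuclideanSpace.single 0 Complex.I
      + (z 1).re • EuclideanSpace.single 1 1 + (z 1).im • EuclideanSpace.single 1 Complex.I) from
      congrArg _ (vec_decomp z)]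
  simp only [map_add, map_smul]
  apply Complex.ext <;> simp [euler, nu, nuBar, dz, dzbar] <;> ring

lemma theta_eq (f : C2 → ℂ) (z : C2) :
    1 / (2 * Complex.I) * theta f z = (-1 / 2 : ℝ) • fderiv ℝ f z (Complex.I • z) := by
  have h1 : (1 / (2 * Complex.I) : ℂ) = -(1 / 2) * Complex.I := by
    field_simp; simp
  conv_rhs => rw [show fderiv ℝ f z (Complex.I • z) = fderiv ℝ f z
      ((-(z 0).im) • (EuclideanSpace.single 0 1 : C2)
      + (z 0).re • EuclideanSpace.single 0 Complex.I
      + (-(z 1).im) • EuclideanSpace.single 1 1 + (z 1).re • EuclideanSpace.single 1 Complex.I) from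
      congrArg _ ((vec_decomp (Complex.I • z)).trans (by simp))]
  simp only [map_add, map_smul, h1]
  apply Complex.ext <;> simp [theta, nu, nuBar, dz, dzbar] <;> ring

/-- A spinor on `ℂ² \ {0}` is smooth. -/
def IsSmooth (φ : Punctured → ℍ[ℝ]) : Prop := ∀ z : Punctured, ContDiffAt ℝ ∞ (extend φ) z

lemma IsSmooth.diff {φ : Punctured → ℍ[ℝ]} (h : IsSmooth φ) (z : Punctured) :
    DifferentiableAt ℝ (extend φ) z := (h z).differentiableAt (by simp)

lemma componentwise_eq (T : (C2 → ℂ) → C2 → ℂ) (r : ℝ) (X : C2 → C2)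
    (hT : ∀ f z, T f z = r • fderiv ℝ f z (X z)) {φ : Punctured → ℍ[ℝ]} (h : IsSmooth φ)
    (z : Punctured) : componentwise T φ z = r • fderiv ℝ (extend φ) z (X z) := by
  have h1 : (extend fun w => fst (φ w)) =
      ((ContinuousLinearMap.fst ℝ ℂ ℂ).comp pairL.symm.toContinuousLinearMap) ∘ extend φ := by
    funext w
    by_cases hw : w = 0
    · simp [extend, hw]
    · rw [extend_of_ne _ hw]
      simp [extend_of_ne _ hw, pairL_symm_apply]
  have h2 : (extend fun w => snd (φ w)) =
      ((ContinuousLinearMap.snd ℝ ℂ ℂ).comp pairL.symm.toContinuousLinearMap) ∘ extend φ := by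
    funext w
    by_cases hw : w = 0
    · simp [extend, hw]
    · rw [extend_of_ne _ hw]
      simp [extend_of_ne _ hw, pairL_symm_apply]
  have h3 : componentwise T φ z = pairL (r • pairL.symm (fderiv ℝ (extend φ) z (X z))) := by
    rw [componentwise, hT, hT, h1, h2,
      fderiv_comp _ (ContinuousLinearMap.differentiableAt _) (h.diff z),
      fderiv_comp _ (ContinuousLinearMap.differentiableAt _) (h.diff z)]
    simp only [ContinuousLinearMap.fderiv]
    rfl
  rw [h3, map_smul, ContinuousLinearEquiv.apply_symm_apply]

lemma d0Fun_eq {φ : Punctured → ℍ[ℝ]} (h : IsSmooth φ) (z : Punctured) :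
    d0Fun φ z = (1 / 2 : ℝ) • fderiv ℝ (extend φ) z z :=
  componentwise_eq _ _ (fun z => z) euler_eq h z

lemma ThetaFun_eq {φ : Punctured → ℍ[ℝ]} (h : IsSmooth φ) (z : Punctured) :
    ThetaFun φ z = (-1 / 2 : ℝ) • fderiv ℝ (extend φ) z (Complex.I • (z : C2)) :=
  componentwise_eq _ _ (fun z => Complex.I • z) theta_eq h z

lemma extend_add (φ ψ : Punctured → ℍ[ℝ]) : extend (φ + ψ) = extend φ + extend ψ := by
  funext z; by_cases h : z = 0 <;> simp [extend, h]

lemma extend_mul (φ ψ : Punctured → ℍ[ℝ]) : extend (φ * ψ) = extend φ * extend ψ := by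
  funext z; by_cases h : z = 0 <;> simp [extend, h]

lemma extend_smul (r : ℝ) (φ : Punctured → ℍ[ℝ]) : extend (r • φ) = r • extend φ := by
  funext z; by_cases h : z = 0 <;> simp [extend, h]

lemma isSmooth_of {φ : Punctured → ℍ[ℝ]} (g : C2 → ℍ[ℝ]) (h : ∀ z : Punctured, φ z = g z)
    (hg : ∀ z : Punctured, ContDiffAt ℝ ∞ g z) : IsSmooth φ := fun z =>
  (hg z).congr_of_eventuallyEq (extend_eventuallyEq φ g h z)

lemma isSmooth_const (q : ℍ[ℝ]) : IsSmooth (fun _ => q) :=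
  isSmooth_of (fun _ => q) (fun _ => rfl) fun _ => contDiffAt_const

lemma IsSmooth.add {φ ψ : Punctured → ℍ[ℝ]} (h : IsSmooth φ) (h' : IsSmooth ψ) :
    IsSmooth (φ + ψ) := fun z => by
  rw [extend_add]; exact (h z).add (h' z)

lemma IsSmooth.mul {φ ψ : Punctured → ℍ[ℝ]} (h : IsSmooth φ) (h' : IsSmooth ψ) :
    IsSmooth (φ * ψ) := fun z => by
  rw [extend_mul]; exact (h z).mul (h' z)

lemma d0Fun_add {φ ψ : Punctured → ℍ[ℝ]} (h : IsSmooth φ) (h' : IsSmooth ψ) :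
    d0Fun (φ + ψ) = d0Fun φ + d0Fun ψ := by
  funext z
  rw [Pi.add_apply, d0Fun_eq h, d0Fun_eq h', d0Fun_eq (h.add h'), extend_add,
    fderiv_add (h.diff z) (h'.diff z)]
  simp

lemma d0Fun_mul {φ ψ : Punctured → ℍ[ℝ]} (h : IsSmooth φ) (h' : IsSmooth ψ) :
    d0Fun (φ * ψ) = d0Fun φ * ψ + φ * d0Fun ψ := by
  funext z
  rw [Pi.add_apply, Pi.mul_apply, Pi.mul_apply, d0Fun_eq h, d0Fun_eq h', d0Fun_eq (h.mul h'),
    extend_mul, fderiv_mul' (h.diff z) (h'.diff z)]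
  simp [extend_apply, add_comm]

lemma ThetaFun_add {φ ψ : Punctured → ℍ[ℝ]} (h : IsSmooth φ) (h' : IsSmooth ψ) :
    ThetaFun (φ + ψ) = ThetaFun φ + ThetaFun ψ := by
  funext z
  rw [Pi.add_apply, ThetaFun_eq h, ThetaFun_eq h', ThetaFun_eq (h.add h'), extend_add,
    fderiv_add (h.diff z) (h'.diff z)]
  simp

lemma isSmooth_smul (r : ℝ) {φ : Punctured → ℍ[ℝ]} (h : IsSmooth φ) : IsSmooth (r • φ) :=
  fun z => by rw [extend_smul]; exact (h z).const_smul r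

lemma d0Fun_smul (r : ℝ) {φ : Punctured → ℍ[ℝ]} (h : IsSmooth φ) :
    d0Fun (r • φ) = r • d0Fun φ := by
  funext z
  rw [Pi.smul_apply, d0Fun_eq h, d0Fun_eq (isSmooth_smul r h), extend_smul,
    fderiv_const_smul (h.diff z), smul_apply, smul_comm]

lemma ThetaFun_smul (r : ℝ) {φ : Punctured → ℍ[ℝ]} (h : IsSmooth φ) :
    ThetaFun (r • φ) = r • ThetaFun φ := by
  funext z
  rw [Pi.smul_apply, ThetaFun_eq h, ThetaFun_eq (isSmooth_smul r h), extend_smul,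
    fderiv_const_smul (h.diff z), smul_apply, smul_comm]

/-- A smooth function on `ℂ²`, homogeneous of degree `m` under real dilations. -/
def SmoothHom (m : ℕ) (f : C2 → ℂ) : Prop :=
  ContDiff ℝ ∞ f ∧ ∀ (t : ℝ) (z : C2), f (t • z) = (t : ℂ) ^ m * f z

lemma contDiff_coord (i : Fin 2) : ContDiff ℝ ∞ (fun z : C2 => z i) :=
  (EuclideanSpace.proj (𝕜 := ℂ) i : C2 →L[ℂ] ℂ).restrictScalars ℝ |>.contDiff

lemma contDiff_coord_conj (i : Fin 2) : ContDiff ℝ ∞ (fun z : C2 => (starRingEnd ℂ) (z i)) :=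
  Complex.conjCLE.contDiff.comp (contDiff_coord i)

lemma SmoothHom.contDiff_fderiv {m : ℕ} {f : C2 → ℂ} (h : SmoothHom m f) (v : C2) :
    ContDiff ℝ ∞ (fun z => fderiv ℝ f z v) :=
  (h.1.fderiv_right (m := ∞) (by simp)).clm_apply contDiff_const

lemma SmoothHom.fderiv_smul {m : ℕ} {f : C2 → ℂ} (h : SmoothHom m f) (t : ℝ) (z v : C2) :
    (t : ℂ) * fderiv ℝ f (t • z) v = (t : ℂ) ^ m * fderiv ℝ f z v := by
  have h1 := fderiv_comp_smul (𝕜 := ℝ) (f := f) (x := z) t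
  have h2 : (fun x => f (t • x)) = fun x => (t : ℂ) ^ m * f x := funext (h.2 t)
  rw [h2, fderiv_const_mul (h.1.differentiable (by simp) z)] at h1
  have h3 := congrArg (fun L => L v) h1
  simpa using h3.symm

lemma SmoothHom.eMinus {m : ℕ} {f : C2 → ℂ} (h : SmoothHom m f) : SmoothHom m (eMinus f) := by
  have c := h.contDiff_fderiv
  refine ⟨?_, fun t z => ?_⟩
  · unfold QuatSpinor.eMinus dz
    have := contDiff_coord_conj
    fun_prop
  · have e := h.fderiv_smul t z
    simp only [QuatSpinor.eMinus, dz, PiLp.smul_apply, Complex.real_smul, map_mul,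
      Complex.conj_ofReal]
    linear_combination
      (-(starRingEnd ℂ) (z 1) * (1 / 2)) * (e (EuclideanSpace.single 0 1))
      + ((starRingEnd ℂ) (z 1) * (1 / 2) * Complex.I) * (e (EuclideanSpace.single 0 Complex.I))
      + ((starRingEnd ℂ) (z 0) * (1 / 2)) * (e (EuclideanSpace.single 1 1))
      - ((starRingEnd ℂ) (z 0) * (1 / 2) * Complex.I) * (e (EuclideanSpace.single 1 Complex.I))

lemma SmoothHom.eHatMinus {m : ℕ} {f : C2 → ℂ} (h : SmoothHom m f) :
    SmoothHom m (eHatMinus f) := by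
  have c := h.contDiff_fderiv
  refine ⟨?_, fun t z => ?_⟩
  · unfold QuatSpinor.eHatMinus dz dzbar
    have := contDiff_coord_conj
    have := contDiff_coord
    fun_prop
  · have e := h.fderiv_smul t z
    simp only [QuatSpinor.eHatMinus, dz, dzbar, PiLp.smul_apply, Complex.real_smul, map_mul,
      Complex.conj_ofReal]
    linear_combination
      ((starRingEnd ℂ) (z 1) * (1 / 2)) * (e (EuclideanSpace.single 0 1))
      + ((starRingEnd ℂ) (z 1) * (1 / 2) * Complex.I) * (e (EuclideanSpace.single 0 Complex.I))
      - (z 0 * (1 / 2)) * (e (EuclideanSpace.single 1 1))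
      + (z 0 * (1 / 2) * Complex.I) * (e (EuclideanSpace.single 1 Complex.I))

lemma smoothHom_vPoly (k a b : ℕ) : SmoothHom (a + b) (vPoly k a b) := by
  induction k with
  | zero =>
    refine ⟨?_, fun t z => ?_⟩
    · have := contDiff_coord
      unfold vPoly
      simp only [Function.iterate_zero, id]
      fun_prop
    · simp [vPoly]; ring
  | succ k ih =>
    have : vPoly (k + 1) a b = eMinus (vPoly k a b) := by
      simp only [vPoly, Function.iterate_succ_apply']
    rw [this]; exact ih.eMinus

lemma smoothHom_wPoly (k a b : ℕ) : SmoothHom (a + b) (wPoly k a b) := by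
  induction k with
  | zero =>
    refine ⟨?_, fun t z => ?_⟩
    · have := contDiff_coord
      have := contDiff_coord_conj
      unfold wPoly
      simp only [Function.iterate_zero, id]
      fun_prop
    · simp [wPoly]; ring
  | succ k ih =>
    have : wPoly (k + 1) a b = eHatMinus (wPoly k a b) := by
      simp only [wPoly, Function.iterate_succ_apply']
    rw [this]; exact ih.eHatMinus

/-- A smooth spinor, homogeneous of integer degree `N` under positive dilations. -/
def SpinorHom (N : ℤ) (φ : Punctured → ℍ[ℝ]) : Prop :=
  IsSmooth φ ∧ ∀ (t : ℝ), 0 < t → ∀ z : Punctured, extend φ (t • (z : C2)) = t ^ N • φ z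

lemma SpinorHom.d0Fun {N : ℤ} {φ : Punctured → ℍ[ℝ]} (h : SpinorHom N φ) :
    d0Fun φ = ((N : ℝ) / 2) • φ := by
  funext z
  rw [d0Fun_eq h.1]
  have h1 : HasDerivAt (fun t : ℝ => t • (z : C2)) (z : C2) 1 := by
    simpa using (hasDerivAt_id (1 : ℝ)).smul_const (z : C2)
  have h2 : HasDerivAt (fun t : ℝ => extend φ (t • (z : C2))) (fderiv ℝ (extend φ) z z) 1 := by
    have h3 : HasFDerivAt (extend φ) (fderiv ℝ (extend φ) z) ((1 : ℝ) • (z : C2)) := by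
      rw [one_smul]; exact (h.1.diff z).hasFDerivAt
    exact h3.comp_hasDerivAt (1 : ℝ) h1
  have h4 : HasDerivAt (fun t : ℝ => t ^ N • φ z) ((N : ℝ) • φ z) 1 := by
    simpa using (hasDerivAt_zpow N (1 : ℝ) (by simp)).smul_const (φ z)
  have h5 : (fun t : ℝ => extend φ (t • (z : C2))) =ᶠ[nhds 1] fun t : ℝ => t ^ N • φ z := by
    filter_upwards [lt_mem_nhds (zero_lt_one : (0 : ℝ) < 1)] with t ht
    exact h.2 t ht z
  rw [(h2.congr_of_eventuallyEq h5.symm).unique h4, smul_smul, Pi.smul_apply]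
  congr 1; ring

lemma spinorHom_of {m : ℕ} {f g : C2 → ℂ} (hf : SmoothHom m f) (hg : SmoothHom m g)
    {φ : Punctured → ℍ[ℝ]} (r : C2 → ℝ) (n : ℤ) (hr : ∀ z : C2, z ≠ 0 → ContDiffAt ℝ ∞ r z)
    (hn : ∀ t : ℝ, 0 < t → ∀ z, r (t • z) = t ^ n * r z) (c : ℂ)
    (h : ∀ z : Punctured, φ z = r z • ofPair (f z) (g z) * ofPair c 0) :
    SpinorHom (n + m) φ := by
  refine ⟨isSmooth_of (fun z => r z • pairL (f z, g z) * ofPair c 0) h fun z => ?_,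
    fun t ht z => ?_⟩
  · refine ContDiffAt.mul ((hr z z.2).smul ?_) contDiffAt_const
    exact pairL.contDiff.contDiffAt.comp (z : C2) (hf.1.prodMk hg.1).contDiffAt
  · have hz : t • (z : C2) ≠ 0 := smul_ne_zero ht.ne' z.2
    rw [extend_of_ne _ hz, h, h]
    have e : ofPair (f (t • (z : C2))) (g (t • (z : C2))) = t ^ m • ofPair (f z) (g z) := by
      rw [hf.2, hg.2]
      have := pairL.map_smul (t ^ m) (f (z : C2), g (z : C2))
      rw [pairL_apply, pairL_apply] at this
      rw [← this]
      simp
    simp only [hn t ht, e, smul_mul_assoc, smul_smul]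
    congr 1
    rw [zpow_add₀ ht.ne', zpow_natCast]; ring

lemma SmoothHom.const_mul {m : ℕ} {f : C2 → ℂ} (h : SmoothHom m f) (c : ℂ) :
    SmoothHom m (fun z => c * f z) :=
  ⟨contDiff_const.mul h.1, fun t z => by simp only [h.2]; ring⟩

lemma exists_spinorHom {φ : Punctured → ℍ[ℝ]} (h : φ ∈ basicSpinors) :
    ∃ N, SpinorHom N φ := by
  obtain ⟨c, m, l, k, hl, -, rfl | rfl⟩ := h
  · have h1 := smoothHom_vPoly (k - 1) l (m - l)
    have h2 := smoothHom_vPoly k l (m - l)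
    exact ⟨_, spinorHom_of (h1.const_mul k) (h2.const_mul (-1)) (fun _ => normConst m l k) 0
      (fun _ _ => contDiffAt_const) (fun t _ z => by simp) c
      (fun z => by simp [phiPlus])⟩
  · have h1 := smoothHom_wPoly k (m + 1 - l) l
    have h2 := smoothHom_wPoly k (m - l) (l + 1)
    rw [show m + 1 - l + l = m + 1 by omega] at h1
    rw [show m - l + (l + 1) = m + 1 by omega] at h2
    refine ⟨_, spinorHom_of h1 h2 (fun z => normConst m l k * (1 / ‖z‖ ^ 2) ^ (m + 2))
      (-(2 * (m + 2) : ℕ)) (fun z hz => ?_) (fun t ht z => ?_) c (fun z => by simp [phiMinus])⟩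
    · refine contDiffAt_const.mul (ContDiffAt.pow ?_ _)
      exact contDiffAt_const.div (contDiff_norm_sq ℝ).contDiffAt (by simpa using hz)
    · rw [norm_smul, Real.norm_of_nonneg ht.le, zpow_neg, zpow_natCast, mul_pow, one_div, one_div,
        mul_inv, mul_pow, pow_mul, inv_pow]
      ring

lemma isSmooth_of_mem {φ : Punctured → ℍ[ℝ]} (h : φ ∈ Laurent) : IsSmooth φ := by
  induction h using Algebra.adjoin_induction with
  | mem x hx => exact (exists_spinorHom hx).choose_spec.1
  | algebraMap r => exact isSmooth_const (algebraMap ℝ ℍ[ℝ] r)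
  | add x y _ _ hx hy => exact hx.add hy
  | mul x y _ _ hx hy => exact hx.mul hy

lemma d0Fun_const (q : ℍ[ℝ]) : d0Fun (fun _ => q) = 0 := by
  have : SpinorHom 0 (fun _ => q) := ⟨isSmooth_const q, fun t ht z => by
    rw [extend_of_ne _ (smul_ne_zero ht.ne' z.2)]; simp⟩
  rw [this.d0Fun]; simp

lemma d0Fun_mem {φ : Punctured → ℍ[ℝ]} (h : φ ∈ Laurent) : d0Fun φ ∈ Laurent := by
  induction h using Algebra.adjoin_induction with
  | mem x hx =>
    rw [(exists_spinorHom hx).choose_spec.d0Fun]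
    exact Laurent.smul_mem (Algebra.subset_adjoin hx) _
  | algebraMap r =>
    have : d0Fun (algebraMap ℝ (Punctured → ℍ[ℝ]) r) = 0 := d0Fun_const (algebraMap ℝ ℍ[ℝ] r)
    rw [this]; exact Laurent.zero_mem
  | add x y hx' hy' hx hy =>
    rw [d0Fun_add (isSmooth_of_mem hx') (isSmooth_of_mem hy')]
    exact Laurent.add_mem hx hy
  | mul x y hx' hy' hx hy =>
    rw [d0Fun_mul (isSmooth_of_mem hx') (isSmooth_of_mem hy')]
    exact Laurent.add_mem (Laurent.mul_mem hx hy') (Laurent.mul_mem hx' hy)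

lemma phiPlus_zero_zero_one : phiPlus 0 0 1 = fun _ => 1 := by
  have h : vPoly 1 0 0 = fun _ => 0 := by
    funext z; simp [vPoly, eMinus, dz]
  have h' : vPoly 0 0 0 = fun _ => 1 := by
    funext z; simp [vPoly]
  funext z
  simp only [phiPlus, normConst, h, h']
  ext <;> simp [re_ofPair, imI_ofPair, imJ_ofPair, imK_ofPair]

/-- `ℂ[φ^±]` is a complex subspace: it is stable under `(u, v) ↦ (c u, c v)`. -/
lemma mul_complex_mem {φ : Punctured → ℍ[ℝ]} (h : φ ∈ Laurent) (c : ℂ) :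
    (φ * fun _ => ofPair c 0) ∈ Laurent := by
  refine Laurent.mul_mem h (Algebra.subset_adjoin ⟨c, 0, 0, 1, le_rfl, le_rfl, Or.inl ?_⟩)
  rw [phiPlus_zero_zero_one]; simp

/-! ### `d₀`, the homogeneous parts, and the cocycle on `ℂ[φ^±]` -/

/-- The radial derivative as a linear operator on `ℂ[φ^±]`. -/
def d0 : Laurent →ₗ[ℝ] Laurent where
  toFun φ := ⟨d0Fun φ, d0Fun_mem φ.2⟩
  map_add' φ ψ := Subtype.ext (d0Fun_add (isSmooth_of_mem φ.2) (isSmooth_of_mem ψ.2))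
  map_smul' r φ := Subtype.ext (d0Fun_smul r (isSmooth_of_mem φ.2))

/-- The point `z / |z|`. -/
def radialProj (z : Punctured) : Punctured :=
  ⟨‖(z : C2)‖⁻¹ • (z : C2), smul_ne_zero (inv_ne_zero (norm_ne_zero_iff.2 z.2)) z.2⟩

/-- `ℂ[φ^±; N]`: the elements of `ℂ[φ^±]` with `φ(z) = |z|^N φ(z / |z|)`. -/
def LaurentDeg (N : ℤ) : Submodule ℝ Laurent where
  carrier := {φ | ∀ z : Punctured, φ.1 z = ‖(z : C2)‖ ^ N • φ.1 (radialProj z)}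
  add_mem' {φ ψ} h h' z := by
    change φ.1 z + ψ.1 z = _ • (φ.1 _ + ψ.1 _)
    rw [h z, h' z, smul_add]
  zero_mem' z := by
    change (0 : ℍ[ℝ]) = _ • (0 : ℍ[ℝ])
    rw [smul_zero]
  smul_mem' r φ h z := by
    change r • φ.1 z = _ • (r • φ.1 _)
    rw [h z, smul_comm]

/-- A point of the unit sphere `S³`, as a point of `ℂ² \ {0}`. -/
def ofSphere (x : Metric.sphere (0 : C2) 1) : Punctured := ⟨x, ne_zero_of_mem_unit_sphere x⟩

lemma integrable_tr {φ ψ : Punctured → ℍ[ℝ]} (h : IsSmooth φ) (h' : IsSmooth ψ) :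
    Integrable (fun x => tr (ThetaFun φ (ofSphere x) * ψ (ofSphere x)))
      (volume : Measure C2).toSphere := by
  have h0 : ∀ x : Metric.sphere (0 : C2) 1, (ofSphere x : C2) = x := fun _ => rfl
  have h1 : Continuous fun x : Metric.sphere (0 : C2) 1 => ψ (ofSphere x) := by
    refine continuous_iff_continuousAt.2 fun x => ?_
    have := ContinuousAt.comp (f := fun x : Metric.sphere (0 : C2) 1 => (x : C2))
      (g := extend ψ) (x := x) (h' (ofSphere x)).continuousAt continuous_subtype_val.continuousAt
    refine this.congr (Filter.Eventually.of_forall fun y => ?_)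
    simp [← h0, extend_apply]
  have h2 : Continuous fun x : Metric.sphere (0 : C2) 1 => ThetaFun φ (ofSphere x) := by
    simp only [ThetaFun_eq h, h0]
    have h5 : Continuous fun x : Metric.sphere (0 : C2) 1 =>
        fderiv ℝ (extend φ) (x : C2) (Complex.I • (x : C2)) := by
      refine continuous_iff_continuousAt.2 fun x => ?_
      have h3 : ContinuousAt (fun z : C2 => fderiv ℝ (extend φ) z (Complex.I • z)) (x : C2) :=
        ((h (ofSphere x)).fderiv_right (m := 0) (by simp)).continuousAt.clm_apply
          (continuous_const_smul Complex.I).continuousAt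
      exact ContinuousAt.comp (f := fun x : Metric.sphere (0 : C2) 1 => (x : C2)) h3
        continuous_subtype_val.continuousAt
    exact h5.const_smul (-1 / 2 : ℝ)
  have h4 : Continuous fun x : Metric.sphere (0 : C2) 1 =>
      tr (ThetaFun φ (ofSphere x) * ψ (ofSphere x)) :=
    continuous_const.mul (Quaternion.continuous_re.comp (h2.mul h1))
  exact h4.integrable_of_hasCompactSupport (HasCompactSupport.of_compactSpace _)

lemma tr_add (p q : ℍ[ℝ]) : tr (p + q) = tr p + tr q := by simp [tr, mul_add]

lemma tr_smul (r : ℝ) (p : ℍ[ℝ]) : tr (r • p) = r * tr p := by simp [tr]; ring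

/-- The cocycle `c(φ, ψ) = (1 / 2π²) ∫_{S³} tr (Θφ · ψ) dσ`, where `σ` is the surface measure of
the unit sphere `S³` of `ℂ²`. -/
def cocycle : LinearMap.BilinForm ℝ Laurent :=
  LinearMap.mk₂ ℝ
    (fun φ ψ => 1 / (2 * Real.pi ^ 2) *
      ∫ x, tr (ThetaFun φ (ofSphere x) * ψ.1 (ofSphere x)) ∂(volume : Measure C2).toSphere)
    (fun φ φ' ψ => by
      have h := isSmooth_of_mem φ.2
      have h' := isSmooth_of_mem φ'.2
      have hψ := isSmooth_of_mem ψ.2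
      rw [← mul_add, ← integral_add (integrable_tr h hψ) (integrable_tr h' hψ)]
      simp only [← tr_add, ← add_mul]
      have := ThetaFun_add h h'
      simp only [Subalgebra.coe_add, this, Pi.add_apply])
    (fun r φ ψ => by
      have := ThetaFun_smul r (isSmooth_of_mem φ.2)
      simp only [Subalgebra.coe_smul, this, Pi.smul_apply, smul_mul_assoc, tr_smul,
        integral_const_mul, smul_eq_mul]
      ring)
    (fun φ ψ ψ' => by
      have h := isSmooth_of_mem φ.2
      have hψ := isSmooth_of_mem ψ.2
      have hψ' := isSmooth_of_mem ψ'.2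
      rw [← mul_add, ← integral_add (integrable_tr h hψ) (integrable_tr h hψ')]
      simp only [← tr_add, ← mul_add]
      rfl)
    (fun r φ ψ => by
      have e : ∀ x, (r • ψ).1 x = r • ψ.1 x := fun _ => rfl
      simp only [e, mul_smul_comm, tr_smul, integral_const_mul, smul_eq_mul]
      ring)

/-! ### The extended algebra -/

section Hat

variable (g : Type*) [LieRing g] [LieAlgebra ℂ g]

/-- The adjoint representation extended to the enveloping algebra, `U(g) → End(g)`. -/
def adU : UniversalEnvelopingAlgebra ℂ g →ₐ[ℂ] Module.End ℂ g :=
  UniversalEnvelopingAlgebra.lift ℂ (LieAlgebra.ad ℂ g)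

/-- The form `(X | Y) = tr (ad X ∘ ad Y)` on `U(g)`. -/
def traceForm : LinearMap.BilinForm ℂ (UniversalEnvelopingAlgebra ℂ g) :=
  ((LinearMap.mul ℂ (Module.End ℂ g)).compl₁₂ (adU g).toLinearMap (adU g).toLinearMap).compr₂
    (LinearMap.trace ℂ g)

/-- `ℂ[φ^±] ⊗ U(g)`, over `ℝ`. The factor `U(g)` is written first, so that its complex scalars
make this tensor product of algebras a complex algebra. -/
abbrev Current := UniversalEnvelopingAlgebra ℂ g ⊗[ℝ] Laurent

/-- The complex vector space `(ℂ[φ^±] ⊗ U(g)) ⊕ ℂ a ⊕ ℂ d`; the last two components of a triple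
are the coefficients of `a` and `d`. -/
abbrev Hat := Current g × ℂ × ℂ

variable {g}

/-- The element `φ ⊗ X`. -/
def tens (φ : Laurent) (X : UniversalEnvelopingAlgebra ℂ g) : Current g := X ⊗ₜ[ℝ] φ

variable (g)

/-- The element `a`. -/
def elemA : Hat g := (0, 1, 0)

/-- The element `d`. -/
def elemD : Hat g := (0, 0, 1)

/-- `d₀ ⊗ id` on `ℂ[φ^±] ⊗ U(g)`. -/
def d0Current : Current g →ₗ[ℂ] Current g :=
  TensorProduct.AlgebraTensorModule.map LinearMap.id d0

/-- The cocycle `c(φ ⊗ X, ψ ⊗ Y) = (X | Y) c(φ, ψ)`. -/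
def cocycleCurrent : LinearMap.BilinForm ℂ (Current g) := (traceForm g).tmul cocycle

variable {g}

/-- The bracket
`[x + λ₁ a + μ₁ d, y + λ₂ a + μ₂ d] = x y - y x + μ₁ d₀ y - μ₂ d₀ x + c(x, y) a`,
for `x`, `y` in the associative algebra `ℂ[φ^±] ⊗ U(g)`. -/
def bracket : Hat g →ₗ[ℂ] Hat g →ₗ[ℂ] Hat g :=
  LinearMap.mk₂ ℂ
    (fun ξ η => (ξ.1 * η.1 - η.1 * ξ.1 + ξ.2.2 • d0Current g η.1 - η.2.2 • d0Current g ξ.1,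
      cocycleCurrent g ξ.1 η.1, 0))
    (fun ξ ξ' η => by
      ext1
      · simp only [Prod.fst_add, Prod.snd_add, add_mul, mul_add, add_smul, map_add, smul_add]; abel
      · ext1 <;> simp)
    (fun r ξ η => by
      ext1
      · simp only [Prod.smul_fst, Prod.smul_snd, smul_mul_assoc, mul_smul_comm, map_smul,
          smul_add, smul_sub, smul_smul, smul_eq_mul, mul_comm]
      · ext1 <;> simp)
    (fun ξ η η' => by
      ext1
      · simp only [Prod.fst_add, Prod.snd_add, add_mul, mul_add, add_smul, map_add, smul_add]; abel
      · ext1 <;> simp)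
    (fun r ξ η => by
      ext1
      · simp only [Prod.smul_fst, Prod.smul_snd, smul_mul_assoc, mul_smul_comm, map_smul,
          smul_add, smul_sub, smul_smul, smul_eq_mul, mul_comm]
      · ext1 <;> simp)

lemma bracket_tens (φ ψ : Laurent) (X Y : UniversalEnvelopingAlgebra ℂ g) (l₁ l₂ m₁ m₂ : ℂ) :
    bracket ((tens φ X, l₁, m₁) : Hat g) (tens ψ Y, l₂, m₂) =
      (tens (φ * ψ) (X * Y) - tens (ψ * φ) (Y * X)
        + m₁ • tens (d0 ψ) Y - m₂ • tens (d0 φ) X,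
        LinearMap.trace ℂ g (adU g X * adU g Y) * (cocycle φ ψ : ℂ), 0) := by
  ext1
  · simp [bracket, tens, d0Current]
  · ext1
    · simp [bracket, tens, cocycleCurrent, traceForm, LinearMap.BilinForm.tmul, mul_comm]
    · simp [bracket]

/-- The centralizer `{η ; [ξ, η] = 0}` of an element `ξ`. -/
def centralizer (ξ : Hat g) : Submodule ℂ (Hat g) := LinearMap.ker (bracket ξ)

lemma mem_centralizer (ξ η : Hat g) : η ∈ centralizer ξ ↔ bracket ξ η = 0 := Iff.rfl

variable (g)

/-- The natural map
`(ℂ[φ^±; N] ⊗ U(g)) ⊕ ℂ ⊕ ℂ → Hat g`, `(x, λ, μ) ↦ x + λ a + μ d`. -/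
def degIncl (N : ℤ) :
    (UniversalEnvelopingAlgebra ℂ g ⊗[ℝ] LaurentDeg N) × ℂ × ℂ →ₗ[ℂ] Hat g :=
  (LinearMap.inl ℂ (Current g) (ℂ × ℂ) ∘ₗ
      TensorProduct.AlgebraTensorModule.map LinearMap.id (LaurentDeg N).subtype).coprod
    ((LinearMap.toSpanSingleton ℂ (Hat g) (elemA g)).coprod
      (LinearMap.toSpanSingleton ℂ (Hat g) (elemD g)))

end Hat

end QuatSpinor

end

/-! Bracketing with `d` differentiates the current component by `d₀ ⊗ id` and ignores the rest: `d`
has no current component, so the commutator and the cocycle contribute nothing (`bracket_elemD`).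
The coefficients of `a` and `d` are therefore unconstrained, and the proposition reduces to
identifying the kernel of `id ⊗ d₀` on `U(g) ⊗ ℂ[φ^±]` with the image of `U(g) ⊗ ℂ[φ^±; 0]`,
together with injectivity of the map from the latter.

Analysis enters only in `ker_d0`, the case without tensor factor. Along a ray `t ↦ t z` the
derivative of a spinor is `2 t⁻¹ d₀φ(t z)`, so `d₀φ = 0` says that `φ` is constant on open rays,
which is homogeneity of degree `0`. Smoothness suffices for this; no decomposition of `ℂ[φ^±]` into
homogeneous parts is needed.

The rest is linear algebra. The sequence `ℂ[φ^±; 0] → ℂ[φ^±] → ℂ[φ^±]`, an inclusion followed by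
`d₀`, is exact, and `U(g)` is flat over the field `ℝ`. Tensoring keeps both the exactness, which
gives the kernel, and the injectivity of the inclusion. -/

namespace QuatSpinor

/-! ### Radial derivatives and the kernel of `d₀` -/

/-- The radial restriction of a smooth spinor has `2 t⁻¹ d₀φ` as its derivative. -/
lemma hasDerivAt_extend_smul {φ : Punctured → ℍ[ℝ]} (hφ : IsSmooth φ) (z : Punctured) {t : ℝ}
    (ht : t ≠ 0) :
    HasDerivAt (fun s : ℝ => extend φ (s • (z : C2)))
      ((2 * t⁻¹) • d0Fun φ ⟨t • (z : C2), smul_ne_zero ht z.2⟩) t := by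
  have h1 : HasDerivAt (fun s : ℝ => s • (z : C2)) (z : C2) t := by
    simpa using (hasDerivAt_id t).smul_const (z : C2)
  have h2 := (hφ.diff ⟨t • (z : C2), smul_ne_zero ht z.2⟩).hasFDerivAt.comp_hasDerivAt t h1
  -- `d₀` at `t z` is half the derivative in the direction `t z`, that is `t / 2` times the
  -- derivative in the direction `z`; this is the source of the factor `2 t⁻¹`.
  have h3 : (2 * t⁻¹) • d0Fun φ ⟨t • (z : C2), smul_ne_zero ht z.2⟩
      = fderiv ℝ (extend φ) (t • (z : C2)) z := by
    rw [d0Fun_eq hφ, map_smul, smul_smul, smul_smul,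
      show 2 * t⁻¹ * (1 / 2) * t = 1 by field_simp, one_smul]
  rw [h3]
  exact h2

/-- A smooth spinor is annihilated by `d₀` exactly when it is radially constant. -/
lemma d0Fun_eq_zero_iff {φ : Punctured → ℍ[ℝ]} (hφ : IsSmooth φ) :
    d0Fun φ = 0 ↔ ∀ z, φ z = φ (radialProj z) := by
  constructor
  · intro h z
    have hd : ∀ t ∈ Set.Ioi (0 : ℝ),
        HasDerivAt (fun s : ℝ => extend φ (s • (z : C2))) 0 t := fun t ht => by
      simpa [h] using hasDerivAt_extend_smul hφ z (ne_of_gt ht)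
    -- The half-line of positive parameters is convex, so a vanishing derivative forces constancy.
    -- The parameters compared are `1` and `‖z‖⁻¹`, which give `z` and `radialProj z`.
    have hc := (convex_Ioi (0 : ℝ)).is_const_of_fderivWithin_eq_zero (𝕜 := ℝ)
      (fun t ht => (hd t ht).differentiableAt.differentiableWithinAt)
      (fun t ht => by
        rw [fderivWithin_of_isOpen isOpen_Ioi ht]
        exact ContinuousLinearMap.ext_ring (hd t ht).deriv)
      (Set.mem_Ioi.2 one_pos) (Set.mem_Ioi.2 (inv_pos.2 (norm_pos_iff.2 z.2)))
    simp only [one_smul] at hc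
    rw [extend_apply] at hc
    exact hc.trans (extend_apply φ (radialProj z))
  · intro h
    funext z
    -- For `t > 0` the points `t z` and `z` have the same projection to the sphere.
    have hr : ∀ t : ℝ, 0 < t → extend φ (t • (z : C2)) = φ z := fun t ht => by
      rw [extend_of_ne φ (smul_ne_zero ht.ne' z.2), h, h z]
      congr 1
      apply Subtype.ext
      change ‖t • (z : C2)‖⁻¹ • (t • (z : C2)) = ‖(z : C2)‖⁻¹ • (z : C2)
      rw [norm_smul, Real.norm_of_nonneg ht.le, smul_smul, mul_inv, mul_right_comm,
        inv_mul_cancel₀ ht.ne', one_mul]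
    -- At `t = 1` the radial restriction has derivative `2 d₀φ(z)`, but it is constant near `1`, so
    -- this derivative is also `0`.
    have h1 := hasDerivAt_extend_smul hφ z one_ne_zero
    have h2 : HasDerivAt (fun s : ℝ => extend φ (s • (z : C2))) 0 1 :=
      (hasDerivAt_const (1 : ℝ) (φ z)).congr_of_eventuallyEq
        (by filter_upwards [Ioi_mem_nhds (zero_lt_one' ℝ)] with t ht using hr t ht)
    simpa using h1.unique h2

/-- For `N = 0` the factor `‖z‖ ^ N` is `1`, so the homogeneity condition becomes radial constancy,
and every element of `ℂ[φ^±]` is smooth. -/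
lemma ker_d0 : LinearMap.ker d0 = LaurentDeg 0 := by
  ext φ
  rw [LinearMap.mem_ker]
  refine Subtype.ext_iff.trans ((d0Fun_eq_zero_iff (isSmooth_of_mem φ.2)).trans ?_)
  change _ ↔ ∀ z : Punctured, φ.1 z = ‖(z : C2)‖ ^ (0 : ℤ) • φ.1 (radialProj z)
  simp only [zpow_zero, one_smul]

/-! ### Flatness and the currents -/

/-- Tensoring with a flat module is exact, for the tensor maps that are linear over an algebra. -/
lemma exact_algebraTensorModule_map {R A M N P Q : Type*} [CommRing R] [CommRing A] [Algebra R A]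
    [AddCommGroup M] [Module R M] [Module A M] [IsScalarTower R A M] [Module.Flat R M]
    [AddCommMonoid N] [Module R N] [AddCommMonoid P] [Module R P] [AddCommMonoid Q] [Module R Q]
    {f : N →ₗ[R] P} {h : P →ₗ[R] Q} (hfh : Function.Exact f h) :
    Function.Exact (TensorProduct.AlgebraTensorModule.map (LinearMap.id : M →ₗ[A] M) f)
      (TensorProduct.AlgebraTensorModule.map (LinearMap.id : M →ₗ[A] M) h) :=
  -- A module over a ring has negatives, namely multiples by `-1`. The group structures required by
  -- `Module.Flat.lTensor_exact` are thus built on the given monoid structures. Exactness concerns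
  -- only the underlying functions, so the `R`-linear statement serves for the `A`-linear maps.
  let _ : AddCommGroup N := Module.addCommMonoidToAddCommGroup R
  let _ : AddCommGroup P := Module.addCommMonoidToAddCommGroup R
  let _ : AddCommGroup Q := Module.addCommMonoidToAddCommGroup R
  Module.Flat.lTensor_exact M hfh

section Hat

variable (g : Type*) [LieRing g] [LieAlgebra ℂ g]

/-- The natural map `ℂ[φ^±; N] ⊗ U(g) → ℂ[φ^±] ⊗ U(g)`. -/
noncomputable def currentIncl (N : ℤ) :
    UniversalEnvelopingAlgebra ℂ g ⊗[ℝ] LaurentDeg N →ₗ[ℂ] Current g :=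
  TensorProduct.AlgebraTensorModule.map LinearMap.id (LaurentDeg N).subtype

/-- A real vector space is flat, so tensoring with `U(g)` preserves the injectivity of a subspace
inclusion. -/
lemma currentIncl_injective (N : ℤ) : Function.Injective (currentIncl g N) :=
  Module.Flat.lTensor_preserves_injective_linearMap (M := UniversalEnvelopingAlgebra ℂ g)
    (LaurentDeg N).subtype (LaurentDeg N).injective_subtype

/-- By `ker_d0` the inclusion of `ℂ[φ^±; 0]` followed by `d₀` is exact, and it stays exact after
tensoring with `U(g)`. -/
lemma d0Current_eq_zero_iff (x : Current g) :
    d0Current g x = 0 ↔ x ∈ Set.range (currentIncl g 0) :=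
  exact_algebraTensorModule_map (f := (LaurentDeg 0).subtype) (h := d0) (fun φ => by
    rw [← LinearMap.mem_ker, ker_d0]
    exact Subtype.range_coe.symm ▸ Iff.rfl) x

/-- In coordinates the natural map is the identity on the coefficients of `a` and `d`, so its range
and its injectivity are decided by the current component. -/
lemma degIncl_apply (N : ℤ)
    (p : (UniversalEnvelopingAlgebra ℂ g ⊗[ℝ] LaurentDeg N) × ℂ × ℂ) :
    degIncl g N p = (currentIncl g N p.1, p.2) := by
  ext1
  · simp [degIncl, elemA, elemD, currentIncl]
  · ext1 <;> simp [degIncl, elemA, elemD]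

/-- Every term of the bracket containing the current component of `d` vanishes, which leaves only
`μ₁ d₀` with `μ₁ = 1`. -/
lemma bracket_elemD (ξ : Hat g) : bracket (elemD g) ξ = (d0Current g ξ.1, 0, 0) := by
  ext1
  · simp [bracket, elemD]
  · ext1 <;> simp [bracket, elemD]

end Hat

end QuatSpinor

theorem mainTheorem10 (g : Type*) [LieRing g] [LieAlgebra ℂ g] [FiniteDimensional ℂ g] :
    QuatSpinor.centralizer (QuatSpinor.elemD g) = LinearMap.range (QuatSpinor.degIncl g 0) ∧
      Function.Injective (QuatSpinor.degIncl g 0) := by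
  refine ⟨?_, fun p q h => ?_⟩
  · ext ξ
    rw [QuatSpinor.mem_centralizer, QuatSpinor.bracket_elemD, LinearMap.mem_range]
    constructor
    · intro h
      obtain ⟨x, hx⟩ := (QuatSpinor.d0Current_eq_zero_iff g ξ.1).1 (Prod.ext_iff.1 h).1
      -- The coefficients of `a` and `d` are carried over unchanged; only the current component
      -- needs a preimage.
      exact ⟨(x, ξ.2), by rw [QuatSpinor.degIncl_apply, hx]⟩
    · rintro ⟨p, rfl⟩
      rw [QuatSpinor.degIncl_apply, (QuatSpinor.d0Current_eq_zero_iff g _).2 ⟨p.1, rfl⟩]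
      rfl
  · rw [QuatSpinor.degIncl_apply, QuatSpinor.degIncl_apply] at h
    exact Prod.ext (QuatSpinor.currentIncl_injective g 0 (Prod.ext_iff.1 h).1)
      (Prod.ext_iff.1 h).2
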